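/- Let $R$ be a Bézout domain, i.e. an integral domain all of whose finitely generated ideals are principal. A pair $(u,v)\in R^2$ is called unimodular if $Ru+Rv=R$. $R$ is called an elementary divisor domain if for all $m,n\ge 1$ every $m\times n$ matrix $A$ with entries in $R$ admits diagonal reduction, i.e. there exist $P\in GL_m(R)$ and $Q\in GL_n(R)$ such that all off-diagonal entries of $PAQ$ are $0$ and each of its diagonal entries divides the next one. Then the following statements are equivalent. (1) $R$ is an elementary divisor domain. (2) For each $(a,b,s)\in R^3$ there exists $(q,r)\in R^2$ such that, with $y:=r+s-asq-bsr$ and $t:=1+q-aq-br$, we have $t\in Ry+Rat$. (2') For each $(a,b,s)\in R^3$ there exists $(q,r)\in R^2$ such that, with $y$ and $t$ as in (2), there exists $(y_1,y_2)\in R^2$ such that $y=y_1y_2$, $y_1$ divides $t$, and $(a,y_2)$ is unimodular. (3) For each $(a,b,s)\in R^3$ there exists a unimodular pair $(e,f)\in R^2$ such that both $(a,e)$ and $(be+af,\,1-bs-a)$ are unimodular. Moreover, for every $(a,b,s,q,r)\in R^5$, with $y$ and $t$ as in (2), we have $t\in Ry+Rat$ if and only if there exists $(y_1,y_2)\in R^2$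 such that $y=y_1y_2$, $y_1$ divides $t$, and $(a,y_2)$ is unimodular. -/

import Mathlib

/-- Two matrices of the same size are equivalent: `B = P * A * Q` with `P` and `Q` invertible. -/
def MatrixEquivalent {R : Type*} [CommRing R] {m n : ℕ}
    (A B : Matrix (Fin m) (Fin n) R) : Prop :=
  ∃ (P : GL (Fin m) R) (Q : GL (Fin n) R),
    B = (P : Matrix (Fin m) (Fin m) R) * A * (Q : Matrix (Fin n) (Fin n) R)

/-- A rectangular matrix admits diagonal reduction if it is equivalent to a matrix whose
off-diagonal entries vanish and in which each diagonal entry divides the next one. -/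
def AdmitsDiagonalReduction {R : Type*} [CommRing R] {m n : ℕ}
    (A : Matrix (Fin m) (Fin n) R) : Prop :=
  ∃ D : Matrix (Fin m) (Fin n) R, MatrixEquivalent A D ∧
    (∀ (i : Fin m) (j : Fin n), (i : ℕ) ≠ (j : ℕ) → D i j = 0) ∧
    (∀ (k : ℕ) (hm : k + 1 < m) (hn : k + 1 < n),
      D ⟨k, Nat.lt_of_succ_lt hm⟩ ⟨k, Nat.lt_of_succ_lt hn⟩ ∣ D ⟨k + 1, hm⟩ ⟨k + 1, hn⟩)

/-- Elementary divisor ring: all matrices, of all sizes, admit diagonal reduction. -/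
def IsElementaryDivisorRing (R : Type*) [CommRing R] : Prop :=
  ∀ m n : ℕ, 1 ≤ m → 1 ≤ n → ∀ A : Matrix (Fin m) (Fin n) R, AdmitsDiagonalReduction A

/-- Elementary divisor domain: an integral domain that is an elementary divisor ring. -/
def IsElementaryDivisorDomain (R : Type*) [CommRing R] : Prop :=
  IsDomain R ∧ IsElementaryDivisorRing R

/-! All conditions pass through Kaplansky's criterion: for unimodular (a, b, c) some row (p, q)
makes (p, q)·[[c, b], [0, a]] = (pc, pb + qa) unimodular. Diagonal reduction of that matrix yields
such a row; conversely, the criterion extends to a unimodular row combination of any matrix with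
entries generating R, so its content splits off and induction diagonalizes (`exists_row_unimodular`,
`exists_border`). Condition (3) is the criterion for the triple (a, b, 1 - bs - a). For (2'), put k
= 1 - aq - br. Then y = r + sk, t = q + k and by + at + k(1 - bs - a) = 1, so choosing (q, r)
amounts to choosing a Bézout relation for by + at and 1 - bs - a. -/

section Bezout

variable {R : Type*} [CommRing R] [IsDomain R] [IsBezout R]

/-- In a Bézout domain, every pair is a multiple of a unimodular pair. -/
theorem exists_eq_mul_isCoprime (a b : R) :
    ∃ g a' b' : R, a = g * a' ∧ b = g * b' ∧ IsCoprime a' b' := by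
  obtain ⟨g, hg⟩ := (IsBezout.span_pair_isPrincipal a b).principal
  have hg' : Ideal.span {a, b} = Ideal.span {g} := hg
  obtain ⟨a', ha⟩ := Ideal.mem_span_singleton.1
    (hg' ▸ Ideal.subset_span (by simp) : a ∈ Ideal.span {g})
  obtain ⟨b', hb⟩ := Ideal.mem_span_singleton.1
    (hg' ▸ Ideal.subset_span (by simp) : b ∈ Ideal.span {g})
  obtain ⟨x, y, hxy⟩ := Ideal.mem_span_pair.1
    (hg'.symm ▸ Ideal.mem_span_singleton_self g : g ∈ Ideal.span {a, b})
  by_cases h0 : g = 0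
  · exact ⟨0, 1, 0, by simp [ha, h0], by simp [hb, h0], isCoprime_one_left⟩
  · refine ⟨g, a', b', ha, hb, x, y, mul_left_cancel₀ h0 ?_⟩
    rw [ha, hb] at hxy
    linear_combination hxy

/-- Cancelling the gcd of y and t leaves coprime y₂, t₂ with t₂ ∈ (y₂, a); hence (y₂, a) contains 1.
-/
theorem mem_span_sup_span_mul_iff (a y t : R) :
    t ∈ (Ideal.span {y} ⊔ Ideal.span {a * t} : Ideal R) ↔
      ∃ y₁ y₂ : R, y = y₁ * y₂ ∧ y₁ ∣ t ∧ IsCoprime a y₂ := by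
  rw [← Ideal.span_insert, Ideal.mem_span_pair]
  constructor
  · rintro ⟨l, m, h⟩
    obtain ⟨g, y₂, t₂, rfl, rfl, u, v, huv⟩ := exists_eq_mul_isCoprime y t
    by_cases h0 : g = 0
    · exact ⟨0, 1, by simp [h0], by simp [h0], isCoprime_one_right⟩
    · refine ⟨g, y₂, rfl, dvd_mul_right _ _, v * m * t₂, u + v * l, ?_⟩
      have h' : l * y₂ + m * (a * t₂) = t₂ := mul_left_cancel₀ h0 (by linear_combination h)
      linear_combination huv + v * h'
  · rintro ⟨y₁, y₂, rfl, ⟨t', rfl⟩, u, v, huv⟩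
    exact ⟨v * t', u, by linear_combination y₁ * t' * huv⟩

theorem exists_factorization_iff_exists_isCoprime (a b s : R) :
    (∃ q r y t : R,
      y = r + s - a * s * q - b * s * r ∧ t = 1 + q - a * q - b * r ∧
      ∃ y₁ y₂ : R, y = y₁ * y₂ ∧ y₁ ∣ t ∧ IsCoprime a y₂) ↔
    ∃ e f : R, IsCoprime e f ∧ IsCoprime a e ∧ IsCoprime (b * e + a * f) (1 - b * s - a) := by
  constructor
  · rintro ⟨q, r, y, t, hy, ht, y₁, y₂, rfl, ⟨t₂, rfl⟩, hay⟩
    have key : y₁ * (b * y₂ + a * t₂) + (1 - a * q - b * r) * (1 - b * s - a) = 1 := by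
      linear_combination b * hy + a * ht
    obtain ⟨g, e, f, rfl, rfl, hef⟩ := exists_eq_mul_isCoprime y₂ t₂
    refine ⟨e, f, hef, hay.of_mul_right_right, y₁ * g, 1 - a * q - b * r, ?_⟩
    linear_combination key
  · rintro ⟨e, f, -, hae, u, k, huk⟩
    -- Solves y = r + sk, t = q + k for y = ue, t = uf; the Bézout relation then forces 1 - aq - br
    -- = k.
    refine ⟨u * f - k, u * e - s * k, u * e, u * f, ?_, ?_, u, e, rfl, dvd_mul_right _ _, hae⟩
    · linear_combination s * huk
    · linear_combination huk

end Bezout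

/-! ### Matrix equivalence and block matrices -/

section Kaplansky

open Matrix

variable {R : Type*} [CommRing R]

namespace MatrixEquivalent

variable {m n : ℕ} {A B C : Matrix (Fin m) (Fin n) R}

theorem refl (A : Matrix (Fin m) (Fin n) R) : MatrixEquivalent A A := ⟨1, 1, by simp⟩

theorem trans (h : MatrixEquivalent A B) (h' : MatrixEquivalent B C) : MatrixEquivalent A C := by
  obtain ⟨P, Q, rfl⟩ := h
  obtain ⟨P', Q', rfl⟩ := h'
  exact ⟨P' * P, Q * Q', by simp only [Units.val_mul, Matrix.mul_assoc]⟩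

theorem symm (h : MatrixEquivalent A B) : MatrixEquivalent B A := by
  obtain ⟨P, Q, rfl⟩ := h
  refine ⟨P⁻¹, Q⁻¹, ?_⟩
  have h1 : ((P⁻¹ : GL (Fin m) R) : Matrix (Fin m) (Fin m) R) * P.1 = 1 := Units.inv_mul P
  have h2 : (Q : Matrix (Fin n) (Fin n) R) * ((Q⁻¹ : GL (Fin n) R) : Matrix _ _ R) = 1 :=
    Units.mul_inv Q
  calc A = ((P⁻¹ : GL (Fin m) R) : Matrix (Fin m) (Fin m) R) * P.1 * A *
        ((Q : Matrix (Fin n) (Fin n) R) * ((Q⁻¹ : GL (Fin n) R) : Matrix _ _ R)) := by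
          rw [h1, h2, Matrix.one_mul, Matrix.mul_one]
    _ = _ := by simp only [Matrix.mul_assoc]

theorem smul (d : R) (h : MatrixEquivalent A B) : MatrixEquivalent (d • A) (d • B) := by
  obtain ⟨P, Q, rfl⟩ := h
  exact ⟨P, Q, by simp⟩

end MatrixEquivalent

/-- The block diagonal matrix with blocks `d` and `B`. -/
def Matrix.border {m n : ℕ} (d : R) (B : Matrix (Fin m) (Fin n) R) :
    Matrix (Fin (m + 1)) (Fin (n + 1)) R :=
  Matrix.of (Fin.cons (Fin.cons d 0) fun i => Fin.cons 0 (B i))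

/-- The unipotent matrix with first column `(1, c)` and the other columns as in the identity. -/
def Matrix.firstColumn {m : ℕ} (c : Fin m → R) : Matrix (Fin (m + 1)) (Fin (m + 1)) R :=
  Matrix.of (Fin.cons (Fin.cons 1 0) fun i => Fin.cons (c i) ((1 : Matrix (Fin m) (Fin m) R) i))

theorem Matrix.border_mul_border {l m n : ℕ} (d e : R) (A : Matrix (Fin l) (Fin m) R)
    (B : Matrix (Fin m) (Fin n) R) : border d A * border e B = border (d * e) (A * B) := by
  ext i j
  refine Fin.cases ?_ (fun i => ?_) i <;> refine Fin.cases ?_ (fun j => ?_) j <;>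
    simp [border, mul_apply, Fin.sum_univ_succ]

theorem Matrix.border_one_one (m : ℕ) :
    border (1 : R) (1 : Matrix (Fin m) (Fin m) R) = 1 := by
  ext i j
  refine Fin.cases ?_ (fun i => ?_) i <;> refine Fin.cases ?_ (fun j => ?_) j <;>
    simp [border, one_apply, Fin.succ_ne_zero, (Fin.succ_ne_zero _).symm]

theorem Matrix.firstColumn_mul_firstColumn {m : ℕ} (c c' : Fin m → R) :
    firstColumn c * firstColumn c' = firstColumn (c + c') := by
  ext i j
  refine Fin.cases ?_ (fun i => ?_) i <;> refine Fin.cases ?_ (fun j => ?_) j <;>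
    simp [firstColumn, mul_apply, Fin.sum_univ_succ, one_apply]

theorem Matrix.firstColumn_zero (m : ℕ) : firstColumn (0 : Fin m → R) = 1 := by
  ext i j
  refine Fin.cases ?_ (fun i => ?_) i <;> refine Fin.cases ?_ (fun j => ?_) j <;>
    simp [firstColumn, one_apply, Fin.succ_ne_zero, (Fin.succ_ne_zero _).symm]

theorem MatrixEquivalent.border {m n : ℕ} {A B : Matrix (Fin m) (Fin n) R} (d : R)
    (h : MatrixEquivalent A B) : MatrixEquivalent (A.border d) (B.border d) := by
  obtain ⟨P, Q, rfl⟩ := h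
  refine ⟨⟨P.1.border 1, P⁻¹.1.border 1, ?_, ?_⟩, ⟨Q.1.border 1, Q⁻¹.1.border 1, ?_, ?_⟩, ?_⟩
  · rw [border_mul_border, Units.mul_inv, one_mul, border_one_one]
  · rw [border_mul_border, Units.inv_mul, one_mul, border_one_one]
  · rw [border_mul_border, Units.mul_inv, one_mul, border_one_one]
  · rw [border_mul_border, Units.inv_mul, one_mul, border_one_one]
  · simp only [border_mul_border, one_mul, mul_one]

/-- A unit which is alone in the first row can be split off. -/
theorem MatrixEquivalent.exists_border {m n : ℕ} (A : Matrix (Fin (m + 1)) (Fin (n + 1)) R)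
    (hu : IsUnit (A 0 0)) (h0 : ∀ j : Fin n, A 0 j.succ = 0) :
    ∃ B : Matrix (Fin m) (Fin n) R, MatrixEquivalent A (B.border (A 0 0)) := by
  obtain ⟨v, hv⟩ := hu.exists_right_inv
  let c : Fin m → R := fun i => A i.succ 0 * v
  refine ⟨Matrix.of fun i j => A i.succ j.succ,
    ⟨firstColumn (-c), firstColumn c, ?_, ?_⟩, 1, ?_⟩
  · rw [firstColumn_mul_firstColumn, neg_add_cancel, firstColumn_zero]
  · rw [firstColumn_mul_firstColumn, add_neg_cancel, firstColumn_zero]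
  · ext i j
    refine Fin.cases ?_ (fun i => ?_) i <;> refine Fin.cases ?_ (fun j => ?_) j <;>
      simp [firstColumn, Matrix.border, mul_apply, Fin.sum_univ_succ, one_apply, h0, c]
    linear_combination A i.succ 0 * hv

/-! ### Reduction of vectors over a Bézout domain -/

section Hermite

variable {ι : Type*} [Fintype ι] [DecidableEq ι]

/-- The action of a `2 × 2` matrix of determinant one on the coordinates `i` and `j`. -/
def pairTransform (i j : ι) (a b c d : R) : Matrix ι ι R :=
  1 + single i i (a - 1) + single i j b + single j i c + single j j (d - 1)

theorem pairTransform_mul {i j : ι} (hij : i ≠ j) (a b c d : R) (h : a * d - b * c = 1) :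
    pairTransform i j a b c d * pairTransform i j d (-b) (-c) a = 1 := by
  have hji := hij.symm
  have e1 : (a - 1) + (d - 1) + (a - 1) * (d - 1) + b * -c = 0 := by linear_combination h
  have e2 : b + -b + (a - 1) * -b + b * (a - 1) = 0 := by ring
  have e3 : c + -c + c * (d - 1) + (d - 1) * -c = 0 := by ring
  have e4 : (d - 1) + (a - 1) + c * -b + (d - 1) * (a - 1) = 0 := by linear_combination h
  have f1 := congrArg (single i i : R → Matrix ι ι R) e1
  have f2 := congrArg (single i j : R → Matrix ι ι R) e2
  have f3 := congrArg (single j i : R → Matrix ι ι R) e3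
  have f4 := congrArg (single j j : R → Matrix ι ι R) e4
  simp only [single_add, single_zero] at f1 f2 f3 f4
  simp only [pairTransform, Matrix.mul_add, Matrix.add_mul, Matrix.one_mul, Matrix.mul_one,
    single_mul_single_same, single_mul_single_of_ne _ _ _ _ hij,
    single_mul_single_of_ne _ _ _ _ hji]
  have f := congrArg₂ (· + ·) (congrArg₂ (· + ·) f1 f2) (congrArg₂ (· + ·) f3 f4)
  refine Eq.trans ?_ ((congrArg (1 + ·) f).trans (by simp))
  abel

theorem pairTransform_mulVec {i j : ι} (hij : i ≠ j) (a b c d : R) (x : ι → R) :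
    pairTransform i j a b c d *ᵥ x =
      Function.update (Function.update x i (a * x i + b * x j)) j (c * x i + d * x j) := by
  ext k
  simp only [pairTransform, add_mulVec, one_mulVec, single_mulVec, Pi.add_apply,
    Function.update_apply, Pi.zero_apply]
  by_cases h1 : k = j
  · subst h1
    simp [hij.symm]
    ring
  · by_cases h2 : k = i
    · subst h2
      simp [hij]
      ring
    · simp [h1, h2]

/-- Bézout domains are Hermite rings. -/
theorem exists_GL_mulVec_eq_single [IsDomain R] [IsBezout R] (i : ι) (x : ι → R) :
    ∃ (Q : GL ι R) (g : R), (Q : Matrix ι ι R) *ᵥ x = Pi.single i g := by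
  have key : ∀ s : Finset ι, i ∉ s →
      ∃ Q : GL ι R, ∀ j ∈ s, ((Q : Matrix ι ι R) *ᵥ x) j = 0 := by
    intro s
    induction s using Finset.induction_on with
    | empty => exact fun _ => ⟨1, by simp⟩
    | insert j s hj ih =>
      intro hi
      rw [Finset.mem_insert, not_or] at hi
      obtain ⟨Q, hQ⟩ := ih hi.2
      set z := (Q : Matrix ι ι R) *ᵥ x with hz
      obtain ⟨g, a, b, ha, hb, u, v, huv⟩ := exists_eq_mul_isCoprime (z i) (z j)
      have hdet : u * a - v * -b = 1 := by linear_combination huv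
      have hdet' : a * u - -v * - -b = 1 := by linear_combination huv
      have hinv := pairTransform_mul hi.1 a (-v) (- -b) u hdet'
      rw [neg_neg, neg_neg] at hinv
      let T : GL ι R := ⟨pairTransform i j u v (-b) a, pairTransform i j a (-v) b u,
        by simpa using pairTransform_mul hi.1 u v (-b) a hdet, hinv⟩
      refine ⟨T * Q, fun k hk => ?_⟩
      have : ((T * Q : GL ι R) : Matrix ι ι R) *ᵥ x = pairTransform i j u v (-b) a *ᵥ z := by
        rw [hz, mulVec_mulVec]; rfl
      rw [this, pairTransform_mulVec hi.1]
      rcases eq_or_ne k j with rfl | hkj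
      · rw [Function.update_self, ha, hb]
        ring
      · have hks : k ∈ s := (Finset.mem_insert.1 hk).resolve_left hkj
        rw [Function.update_of_ne hkj, Function.update_of_ne (ne_of_mem_of_not_mem hks hi.2), hQ k hks]
  obtain ⟨Q, hQ⟩ := key (Finset.univ.erase i) (by simp)
  refine ⟨Q, ((Q : Matrix ι ι R) *ᵥ x) i, ?_⟩
  ext j
  rcases eq_or_ne j i with rfl | h
  · simp
  · rw [Pi.single_eq_of_ne h, hQ j (by simp [h])]

theorem eq_smul_col_inv_of_mulVec_eq_single {Q : GL ι R} {i : ι} {g : R} {x : ι → R}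
    (h : (Q : Matrix ι ι R) *ᵥ x = Pi.single i g) :
    x = g • fun j => (Q⁻¹ : GL ι R).1 j i := by
  have h1 : (Q⁻¹ : GL ι R).1 *ᵥ ((Q : Matrix ι ι R) *ᵥ x) = x := by
    rw [mulVec_mulVec, Units.inv_mul, one_mulVec]
  rw [← h1, h]
  ext j
  simp [mul_comm]

/-- Every vector over a Bézout domain is a multiple of a unimodular vector. -/
theorem exists_eq_smul_unimodular [IsDomain R] [IsBezout R] [Nonempty ι] (x : ι → R) :
    ∃ (d : R) (x' v : ι → R), x = d • x' ∧ v ⬝ᵥ x' = 1 := by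
  obtain ⟨i⟩ := ‹Nonempty ι›
  obtain ⟨Q, g, h⟩ := exists_GL_mulVec_eq_single i x
  refine ⟨g, _, Q.1 i, eq_smul_col_inv_of_mulVec_eq_single h, ?_⟩
  have := congrFun (congrFun (Units.mul_inv Q) i) i
  rwa [mul_apply, one_apply_eq] at this

end Hermite

/-! ### Kaplansky's criterion and diagonal reduction -/

/-- Kaplansky's condition on triangular `2 × 2` matrices with unimodular entries. -/
def KaplanskyCondition (R : Type*) [CommRing R] : Prop :=
  ∀ a b c : R, (∃ u v w, u * a + v * b + w * c = 1) →
    ∃ p q : R, IsCoprime (p * c) (p * b + q * a)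

namespace KaplanskyCondition

variable [IsDomain R] [IsBezout R]

theorem exists_pair_unimodular (hK : KaplanskyCondition R) {κ : Type*} [Fintype κ]
    [Nonempty κ] (x y v w : κ → R) (h : v ⬝ᵥ x + w ⬝ᵥ y = 1) :
    ∃ (p q : R) (z : κ → R), (p • x + q • y) ⬝ᵥ z = 1 := by
  classical
  obtain ⟨g, x', v', hx, hv'⟩ := exists_eq_smul_unimodular x
  -- Removing the x'-component of y makes the pair triangular: x = g x', y = β x' + k y'.
  obtain ⟨k, y', w', hy, hw'⟩ := exists_eq_smul_unimodular (y - (y ⬝ᵥ v') • x')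
  set β := y ⬝ᵥ v' with hβ
  have hy2 : y = β • x' + k • y' := by rw [← hy]; abel
  have hyv : k * (y' ⬝ᵥ v') = 0 := by
    have h2 := hβ
    rw [hy2, add_dotProduct, smul_dotProduct, smul_dotProduct, dotProduct_comm x', hv'] at h2
    simp only [smul_eq_mul] at h2
    linear_combination -h2
  obtain ⟨q, p, e, f, hef⟩ := hK g β k ⟨v ⬝ᵥ x', w ⬝ᵥ x', w ⬝ᵥ y', by
    rw [hx, hy2] at h
    simp only [dotProduct_smul, dotProduct_add, smul_eq_mul] at h
    linear_combination h⟩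
  -- The vector multiplying e annihilates x', while v' annihilates k y', so the pairing is f(pg +
  -- qβ) + e(qk).
  refine ⟨p, q, f • v' + e • (w' - (x' ⬝ᵥ w') • v'), ?_⟩
  rw [hx, hy2]
  simp only [add_dotProduct, smul_dotProduct, dotProduct_add, dotProduct_smul, dotProduct_sub,
    smul_eq_mul, dotProduct_comm x' v', hv', dotProduct_comm y' w', hw']
  linear_combination hef + (q * f - q * e * (x' ⬝ᵥ w')) * hyv

theorem exists_row_unimodular (hK : KaplanskyCondition R) {κ : Type*} [Fintype κ]
    [Nonempty κ] : ∀ (m : ℕ) (A V : Matrix (Fin (m + 1)) κ R), ∑ i, V i ⬝ᵥ A i = 1 →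
      ∃ (u : Fin (m + 1) → R) (z : κ → R), (u ᵥ* A) ⬝ᵥ z = 1 := by
  classical
  intro m
  induction m with
  | zero =>
    intro A V h
    refine ⟨1, V 0, ?_⟩
    rw [Fin.sum_univ_one, dotProduct_comm] at h
    rw [← h]
    congr 1
    ext j
    simp [vecMul, dotProduct]
  | succ m ih =>
    intro A V h
    -- The lower rows need not have unit content; d is stripped for the induction and restored when
    -- pairing with the top row.
    obtain ⟨d, x', v', hx, hv'⟩ :=
      exists_eq_smul_unimodular (fun ij : Fin (m + 1) × κ => A ij.1.succ ij.2)
    let A' : Matrix (Fin (m + 1)) κ R := Matrix.of fun i j => x' (i, j)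
    obtain ⟨u, z, huz⟩ := ih A' (Matrix.of fun i j => v' (i, j)) (by
      rw [← hv']
      simp [dotProduct, Fintype.sum_prod_type, A'])
    have hA : ∀ i : Fin (m + 1), A i.succ = d • A' i := fun i => by
      ext j
      exact congrFun hx (i, j)
    rw [Fin.sum_univ_succ] at h
    obtain ⟨p, q, z', hz'⟩ := hK.exists_pair_unimodular (A 0) (d • (u ᵥ* A')) (V 0)
      ((∑ i : Fin (m + 1), V i.succ ⬝ᵥ A' i) • z) (by
        rw [← h, smul_dotProduct, dotProduct_smul, dotProduct_comm z, huz]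
        simp only [hA, dotProduct_smul, smul_eq_mul, mul_one, ← Finset.mul_sum]
        ring)
    refine ⟨Fin.cons p (q • u), z', ?_⟩
    rw [← hz']
    congr 1
    ext j
    simp only [vecMul, dotProduct, Fin.sum_univ_succ, Fin.cons_zero, Fin.cons_succ, hA,
      Pi.add_apply, Pi.smul_apply, smul_eq_mul, mul_add, Finset.mul_sum]
    congr 2
    · ring
    · exact Finset.sum_congr rfl fun i _ => by ring

/-- Splitting off the content of a matrix. -/
theorem exists_border (hK : KaplanskyCondition R) {m n : ℕ}
    (A : Matrix (Fin (m + 1)) (Fin (n + 1)) R) :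
    ∃ (d : R) (e : R) (B : Matrix (Fin m) (Fin n) R), IsUnit e ∧
      MatrixEquivalent A (d • B.border e) := by
  obtain ⟨d, x', v', hx, hv'⟩ :=
    exists_eq_smul_unimodular (fun ij : Fin (m + 1) × Fin (n + 1) => A ij.1 ij.2)
  let A' : Matrix (Fin (m + 1)) (Fin (n + 1)) R := Matrix.of fun i j => x' (i, j)
  have hA : A = d • A' := by
    ext i j
    exact congrFun hx (i, j)
  obtain ⟨u, z, huz⟩ := hK.exists_row_unimodular m A' (Matrix.of fun i j => v' (i, j)) (by
    rw [← hv']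
    simp [dotProduct, Fintype.sum_prod_type, A'])
  obtain ⟨P, g, hP⟩ := exists_GL_mulVec_eq_single 0 u
  have hu := eq_smul_col_inv_of_mulVec_eq_single hP
  set w : Fin (n + 1) → R := (fun j => (P⁻¹).1 j 0) ᵥ* A' with hw
  have hwz : g * (w ⬝ᵥ z) = 1 := by
    rw [← huz, hu, smul_vecMul, smul_dotProduct, smul_eq_mul]
  obtain ⟨Q, e, hQ⟩ := exists_GL_mulVec_eq_single 0 w
  have hwe := eq_smul_col_inv_of_mulVec_eq_single hQ
  have he : IsUnit e := by
    rw [hwe, smul_dotProduct, smul_eq_mul] at hwz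
    exact IsUnit.of_mul_eq_one (g * ((fun j => (Q⁻¹).1 j 0) ⬝ᵥ z)) (by linear_combination hwz)
  let P' : GL (Fin (m + 1)) R := ⟨P⁻¹.1ᵀ, P.1ᵀ,
    by rw [← transpose_mul, Units.mul_inv, transpose_one],
    by rw [← transpose_mul, Units.inv_mul, transpose_one]⟩
  let Q' : GL (Fin (n + 1)) R := ⟨Q.1ᵀ, Q⁻¹.1ᵀ,
    by rw [← transpose_mul, Units.inv_mul, transpose_one],
    by rw [← transpose_mul, Units.mul_inv, transpose_one]⟩
  have hrow : ∀ j, (P'.1 * A' * Q'.1) 0 j = (Pi.single 0 e : Fin (n + 1) → R) j := by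
    intro j
    rw [← hQ]
    change (P⁻¹.1ᵀ * A' * Q.1ᵀ) 0 j = _
    rw [mul_apply]
    simp only [mulVec, dotProduct, transpose_apply, hw, vecMul, mul_apply]
    exact Finset.sum_congr rfl fun i _ => mul_comm _ _
  obtain ⟨B, hB⟩ := MatrixEquivalent.exists_border (P'.1 * A' * Q'.1)
    (by rw [hrow, Pi.single_eq_same]; exact he)
    (fun j => by rw [hrow, Pi.single_eq_of_ne (Fin.succ_ne_zero j)])
  rw [hrow, Pi.single_eq_same] at hB
  refine ⟨d, e, B, he, ?_⟩
  rw [hA]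
  exact (MatrixEquivalent.trans ⟨P', Q', rfl⟩ hB).smul d

theorem admitsDiagonalReduction (hK : KaplanskyCondition R) :
    ∀ (m n : ℕ) (A : Matrix (Fin m) (Fin n) R), AdmitsDiagonalReduction A := by
  intro m
  induction m with
  | zero => exact fun n A => ⟨A, .refl A, fun i => i.elim0, fun k hm => absurd hm (by omega)⟩
  | succ m ih =>
    intro n A
    cases n with
    | zero => exact ⟨A, .refl A, fun _ j => j.elim0, fun k _ hn => absurd hn (by omega)⟩
    | succ n =>
      obtain ⟨d, e, B, he, hAB⟩ := hK.exists_border A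
      obtain ⟨D, hBD, hoff, hdvd⟩ := ih n B
      refine ⟨d • D.border e, hAB.trans ((hBD.border e).smul d), ?_, ?_⟩
      · intro i j
        refine Fin.cases ?_ (fun i => ?_) i <;> refine Fin.cases ?_ (fun j => ?_) j <;>
          intro hij
        · exact absurd rfl hij
        · simp [Matrix.border]
        · simp [Matrix.border]
        · simp [Matrix.border, hoff i j (fun h => hij (by simp [h]))]
      · intro k hm hn
        cases k with
        -- The leading entry is d times a unit, so it divides every multiple of d.
        | zero => exact mul_dvd_mul_left d he.dvd
        | succ k => exact mul_dvd_mul_left d (hdvd k (by omega) (by omega))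

end KaplanskyCondition

theorem kaplanskyCondition_iff :
    KaplanskyCondition R ↔ ∀ a b s : R, ∃ e f : R, IsCoprime e f ∧
      IsCoprime a e ∧ IsCoprime (b * e + a * f) (1 - b * s - a) := by
  constructor
  · intro hK a b s
    obtain ⟨p, q, h⟩ := hK a b (1 - b * s - a) ⟨1, s, 1, by ring⟩
    have h1 : IsCoprime p (q * a) := by
      have := h.of_mul_left_left
      rwa [IsCoprime.mul_add_left_right_iff] at this
    refine ⟨p, q, h1.of_mul_right_left, h1.of_mul_right_right.symm, ?_⟩
    rw [mul_comm b, mul_comm a]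
    exact h.of_mul_left_right.symm
  · rintro h a b c ⟨u, v, w, huvw⟩
    -- With ua for a and v for s, the element 1 - bs - a becomes wc.
    obtain ⟨e, f, hef, hae, hc⟩ := h (u * a) b v
    have hc' : 1 - b * v - u * a = w * c := by linear_combination -huvw
    rw [hc'] at hc
    refine ⟨e, u * f, IsCoprime.mul_left ?_ ?_⟩
    · rw [IsCoprime.mul_add_left_right_iff, mul_right_comm]
      exact hae.symm.mul_right hef
    · rw [show e * b + u * f * a = b * e + u * a * f by ring]
      exact hc.of_mul_right_right.symm

theorem IsElementaryDivisorRing.kaplanskyCondition (h : IsElementaryDivisorRing R) :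
    KaplanskyCondition R := by
  rintro a b c ⟨u, v, w, huvw⟩
  obtain ⟨D, hAD, hoff, hdvd⟩ := h 2 2 one_le_two one_le_two !![c, b; 0, a]
  have h01 : D 0 1 = 0 := hoff 0 1 (by simp)
  have h10 : D 1 0 = 0 := hoff 1 0 (by simp)
  obtain ⟨x, hx⟩ : D 0 0 ∣ D 1 1 := hdvd 0 (by omega) (by omega)
  obtain ⟨P', Q', hA⟩ := hAD.symm
  obtain ⟨P, Q, hD⟩ := hAD
  -- Since D 0 0 divides all of D, it divides the entries of the original matrix and is a unit; the
  -- first row of P is then the required (p, q).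
  have hdiv : ∀ i j, D 0 0 ∣ (!![c, b; 0, a] : Matrix (Fin 2) (Fin 2) R) i j := by
    intro i j
    rw [hA, mul_apply, Fin.sum_univ_two, mul_apply, mul_apply, Fin.sum_univ_two,
      Fin.sum_univ_two, h01, h10, hx]
    exact ⟨P'.1 i 0 * Q'.1 0 j + P'.1 i 1 * x * Q'.1 1 j, by ring⟩
  have hunit : IsUnit (D 0 0) := by
    rw [isUnit_iff_dvd_one, ← huvw]
    exact dvd_add (dvd_add ((hdiv 1 1).mul_left u) ((hdiv 0 1).mul_left v))
      ((hdiv 0 0).mul_left w)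
  obtain ⟨y, hy⟩ := hunit.exists_left_inv
  have h00 := congrFun (congrFun hD 0) 0
  simp [mul_apply, Fin.sum_univ_two] at h00
  refine ⟨P.1 0 0, P.1 0 1, y * Q.1 0 0, y * Q.1 1 0, ?_⟩
  linear_combination hy - y * h00

end Kaplansky

theorem mainTheorem8 {R : Type*} [CommRing R] [IsDomain R] [IsBezout R] :
    List.TFAE
      [ IsElementaryDivisorDomain R,
        ∀ a b s : R, ∃ q r y t : R,
          y = r + s - a * s * q - b * s * r ∧ t = 1 + q - a * q - b * r ∧
          t ∈ (Ideal.span {y} ⊔ Ideal.span {a * t} : Ideal R),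
        ∀ a b s : R, ∃ q r y t : R,
          y = r + s - a * s * q - b * s * r ∧ t = 1 + q - a * q - b * r ∧
          ∃ y₁ y₂ : R, y = y₁ * y₂ ∧ y₁ ∣ t ∧ IsCoprime a y₂,
        ∀ a b s : R, ∃ e f : R, IsCoprime e f ∧
          IsCoprime a e ∧ IsCoprime (b * e + a * f) (1 - b * s - a) ] ∧
    (∀ a b s q r y t : R,
      y = r + s - a * s * q - b * s * r → t = 1 + q - a * q - b * r →
      (t ∈ (Ideal.span {y} ⊔ Ideal.span {a * t} : Ideal R) ↔
        ∃ y₁ y₂ : R, y = y₁ * y₂ ∧ y₁ ∣ t ∧ IsCoprime a y₂)) := by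
  refine ⟨?_, fun a _ _ _ _ y t _ _ => mem_span_sup_span_mul_iff a y t⟩
  tfae_have 1 → 4 := fun h => kaplanskyCondition_iff.1 h.2.kaplanskyCondition
  tfae_have 4 → 1 := fun h =>
    ⟨inferInstance, fun m n _ _ => (kaplanskyCondition_iff.2 h).admitsDiagonalReduction m n⟩
  tfae_have 2 ↔ 3 := by simp only [mem_span_sup_span_mul_iff]
  tfae_have 3 ↔ 4 := by simp only [exists_factorization_iff_exists_isCoprime]
  tfae_finish
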